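/- Let $\Gamma$ be an adversarial team game: $n\ge 1$ team players with finite nonempty action sets $\mathcal A_1,\dots,\mathcal A_n$, one adversary with a finite nonempty action set $\mathcal B$, and a payoff $U:\prod_i\mathcal A_i\times\mathcal B\to\mathbb R$ that the team minimizes and the adversary maximizes. Let $V$ be the maximum of $|U|$, $\mathcal X=\prod_i\Delta(\mathcal A_i)$, $\mathcal Y=\Delta(\mathcal B)$, and let $U(x,y)$ also denote the expected payoff (and its multilinear extension to all real vectors). Write $P(\Gamma)=P(\sum_i|\mathcal A_i|,|\mathcal B|,V)$ for a polynomial $P$ with natural coefficients. A pair $(x,y)\in\mathcal X\times\mathcal Y$ is an $\epsilon$-approximate Nash equilibrium if no single player can improve by more than $\epsilon$ by a unilateral deviation. For $\ell>0$ call $U$ $\ell$-smooth if $\nabla U$ is $\ell$-Lipschitz on $\mathcal X\times\mathcal Y$ for the Euclidean norm. Let $\phi(x)=\max_{y\in\mathcal Y}U(x,y)$. A $\delta$-approximate proximal map is any map $\mathrm{prox}$ such that for each $x\in\mathcal X$, $\mathrm{prox}(x)\in\mathcal X$ and $$\phi(\mathrm{prox}(x))+\ell\|x-\mathrm{prox}(x)\|_2^2\le\min_{x'\in\mathcal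 X}\{\phi(x')+\ell\|x-x'\|_2^2\}+\delta;$$ its potential is $$g(x)=\max_{y\in\mathcal Y}U(\mathrm{prox}(x),y)+\ell\|x-\mathrm{prox}(x)\|_2^2 .$$ $\textsc{GradientDescentMax}$ with precision $\epsilon>0$, step size $\eta$ and $T$ iterations starts at an arbitrary $(x^{(0)},y^{(0)})\in\mathcal X\times\mathcal Y$. In iteration $t=1,\dots,T$ it stops if $(x^{(t-1)},y^{(t-1)})$ is an $\epsilon$-approximate Nash equilibrium; otherwise it takes a best response $y'^{(t)}\in\arg\max_{y\in\mathcal Y}U(x^{(t-1)},y)$, sets $x^{(t)}_i=\Pi_{\Delta(\mathcal A_i)}\{x^{(t-1)}_i-\eta\nabla_{x_i}U(x^{(t-1)},y'^{(t)})\}$ for all $i$ (with $\Pi$ the Euclidean projection), and lets $y^{(t)}=\mathtt{ExtendNE}(x^{(t)})$, where $\mathtt{ExtendNE}(x)$ is the $y$-part of any optimal solution $(z,y)$ of the linear program: maximize $\sum_i z_i$ subject to $z_i\le\sum_{b\in\mathcal B}y(b)\,U(a,x_{-i},b)$ for all $i$ and $a\in\mathcal A_i$, and $y\in\Delta(\mathcal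 B)$. **Theorem.** (a) There is a polynomial $R$ such that in every game $\Gamma$, $R(\Gamma)>0$ and $U$ is $R(\Gamma)$-smooth. (b) For every polynomial $R$ there is a polynomial $P$ such that the following holds for every game $\Gamma$ and every $0<\ell\le R(\Gamma)$ for which $U$ is $\ell$-smooth. We have $P(\Gamma)\ge1$. Let $\epsilon>0$, $0<c\le 1/P(\Gamma)$, step size $\eta=c\,\epsilon^2$, $0\le\delta\le c\,\epsilon^4/P(\Gamma)$, and let $g$ be the potential of any $\delta$-approximate proximal map. Then: 1. $|g(x)|\le P(\Gamma)$ for all $x\in\mathcal X$. 2. In every run of $\textsc{GradientDescentMax}$, $$g(x^{(t)})<g(x^{(t-1)})-\frac{c}{P(\Gamma)}\,\epsilon^4$$ for every iteration $1\le t\le T$ that is executed (the algorithm has not stopped at or before the start of iteration $t$), provided that $t\ge2$ or that $y^{(0)}$ is an output of $\mathtt{ExtendNE}(x^{(0)})$. 3. If $T\ge P(\Gamma)/(c\,\epsilon^4)$, then in every run some $(x^{(t)},y^{(t)})$ with $t\le P(\Gamma)/(c\,\epsilon^4)$ is an $\epsilon$-approximate Nash equilibrium. In particular, with $c=1/P(\Gamma)$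 the step size is $\Theta(\epsilon^2)$, the decrease per iteration is $\Omega(\epsilon^4)$, and the algorithm terminates after $\mathrm{poly}(\Gamma)/\epsilon^4$ iterations (constants up to $\mathrm{poly}(\Gamma)$ factors). -/

import Mathlib

namespace TeamGame

/-!
An adversarial team game: `n` team players (minimizers) with finite action sets `A i`, one
adversary (maximizer) with finite action set `B`, and a payoff tensor `u`. The team receives
`-u`, the adversary `u`.
-/

noncomputable section

variable {n : ℕ} {A : Fin n → Type*} {B : Type*} [∀ i, Fintype (A i)] [Fintype B]

/-- The space `∏ i, ℝ^(A i)` with its Euclidean norm. -/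
abbrev TeamVec {n : ℕ} (A : Fin n → Type*) [∀ i, Fintype (A i)] :=
  PiLp 2 (fun i => EuclideanSpace ℝ (A i))

/-- The space `ℝ^B` with its Euclidean norm. -/
abbrev AdvVec (B : Type*) [Fintype B] := EuclideanSpace ℝ B

/-- The probability simplex `Δ(S)` as a subset of Euclidean space. -/
def simplex (S : Type*) [Fintype S] : Set (EuclideanSpace ℝ S) :=
  {v | v.ofLp ∈ stdSimplex ℝ S}

/-- The set of team strategies, the product of the simplices `Δ(A i)`. -/
def teamStrategies {n : ℕ} (A : Fin n → Type*) [∀ i, Fintype (A i)] : Set (TeamVec A) :=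
  {x | ∀ i, x i ∈ simplex (A i)}

/-- The expected payoff `U(x, y)`: the expectation of `u a b` for independent `a i ∼ x i`,
`b ∼ y`. The same formula defines its multilinear extension to all vectors. -/
def payoff (u : (∀ i, A i) → B → ℝ) (x : TeamVec A) (y : AdvVec B) : ℝ :=
  ∑ a : (∀ i, A i), ∑ b : B, (∏ i, x i (a i)) * y b * u a b

/-- The profile `(v, x_{-i})`. -/
def deviate (x : TeamVec A) (i : Fin n) (v : EuclideanSpace ℝ (A i)) : TeamVec A :=
  WithLp.toLp 2 (Function.update x.ofLp i v)

open Classical in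
/-- The pure strategy that plays `s` with probability one. -/
def pureStrategy {S : Type*} [Fintype S] (s : S) : EuclideanSpace ℝ S :=
  EuclideanSpace.single s 1

/-- `ε`-approximate Nash equilibria. -/
structure IsApproxNash (u : (∀ i, A i) → B → ℝ) (ε : ℝ) (x : TeamVec A) (y : AdvVec B) :
    Prop where
  team_mem : x ∈ teamStrategies A
  adv_mem : y ∈ simplex B
  team : ∀ i, ∀ v ∈ simplex (A i), payoff u x y ≤ payoff u (deviate x i v) y + ε
  adv : ∀ y' ∈ simplex B, payoff u x y ≥ payoff u x y' - ε

/-- `U` is `ℓ`-smooth: on pairs of mixed strategies its full gradient is `ℓ`-Lipschitz for the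
Euclidean norm on `∏ i, ℝ^(A i) × ℝ^B`. -/
def IsSmooth (u : (∀ i, A i) → B → ℝ) (l : ℝ) : Prop :=
  ∀ z z' : WithLp 2 (TeamVec A × AdvVec B),
    z.fst ∈ teamStrategies A → z.snd ∈ simplex B →
    z'.fst ∈ teamStrategies A → z'.snd ∈ simplex B →
    ‖gradient (fun w : WithLp 2 (TeamVec A × AdvVec B) => payoff u w.fst w.snd) z
      - gradient (fun w : WithLp 2 (TeamVec A × AdvVec B) => payoff u w.fst w.snd) z'‖
      ≤ l * ‖z - z'‖

/-- `φ(x) = max_y U(x, y)` over the mixed strategies `y` of the adversary (a maximum, since the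
simplex is compact and `U(x, ·)` continuous). -/
def phi (u : (∀ i, A i) → B → ℝ) (x : TeamVec A) : ℝ :=
  sSup ((fun y => payoff u x y) '' simplex B)

/-- `p` is a `δ`-approximate solution in value of `min_{x'} φ(x') + ℓ ‖x - x'‖²` over team
strategies `x'`. -/
def IsApproxProx (u : (∀ i, A i) → B → ℝ) (l δ : ℝ) (x p : TeamVec A) : Prop :=
  p ∈ teamStrategies A ∧
    ∀ q ∈ teamStrategies A, phi u p + l * ‖x - p‖ ^ 2 ≤ phi u q + l * ‖x - q‖ ^ 2 + δ

/-- The potential `g(x) = max_y U(prox(x), y) + ℓ ‖x - prox(x)‖²`. -/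
def potential (u : (∀ i, A i) → B → ℝ) (l : ℝ) (prox : TeamVec A → TeamVec A)
    (x : TeamVec A) : ℝ :=
  phi u (prox x) + l * ‖x - prox x‖ ^ 2

/-- `y` is a best response of the adversary to `x`. -/
def IsBestResponse (u : (∀ i, A i) → B → ℝ) (x : TeamVec A) (y : AdvVec B) : Prop :=
  y ∈ simplex B ∧ ∀ y' ∈ simplex B, payoff u x y' ≤ payoff u x y

/-- `p` is the Euclidean projection of `v` to `S`. -/
def IsProjection {E : Type*} [NormedAddCommGroup E] (S : Set E) (v p : E) : Prop :=
  p ∈ S ∧ ∀ q ∈ S, ‖v - p‖ ≤ ‖v - q‖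

/-- Feasibility of `(z, y)` for the linear program: maximize `∑ i, z i` subject to
`z i ≤ ∑ b, y b * U(a, x_{-i}, b)` for all `i` and all `a : A i`, and `y ∈ Δ(B)`. -/
def IsDualFeasible (u : (∀ i, A i) → B → ℝ) (x : TeamVec A) (z : Fin n → ℝ) (y : AdvVec B) :
    Prop :=
  y ∈ simplex B ∧ ∀ (i : Fin n) (a : A i),
    z i ≤ ∑ b : B, y b * payoff u (deviate x i (pureStrategy a)) (pureStrategy b)

/-- `y` is a possible output of `ExtendNE(x)`: the `y`-part of an optimal solution of the linear
program above. -/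
def IsExtendNE (u : (∀ i, A i) → B → ℝ) (x : TeamVec A) (y : AdvVec B) : Prop :=
  ∃ z : Fin n → ℝ, IsDualFeasible u x z y ∧
    ∀ z' y', IsDualFeasible u x z' y' → ∑ i, z' i ≤ ∑ i, z i

/-- No `ε`-approximate Nash equilibrium has been found among the iterates `0, …, t`, that is, the
algorithm does not break at or before the start of iteration `t + 1`. -/
def NotTerminated (u : (∀ i, A i) → B → ℝ) (ε : ℝ) (x : ℕ → TeamVec A) (y : ℕ → AdvVec B)
    (t : ℕ) : Prop :=
  ∀ s ≤ t, ¬ IsApproxNash u ε (x s) (y s)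

/-- `(x, y, y')` is a run of `GradientDescentMax` with precision `ε`, step size `η` and at most
`T` iterations. The values after termination are irrelevant and not constrained. -/
structure IsGDMaxRun (u : (∀ i, A i) → B → ℝ) (ε η : ℝ) (T : ℕ) (x : ℕ → TeamVec A)
    (y y' : ℕ → AdvVec B) : Prop where
  init_team : x 0 ∈ teamStrategies A
  init_adv : y 0 ∈ simplex B
  best_response : ∀ t < T, NotTerminated u ε x y t → IsBestResponse u (x t) (y' (t + 1))
  gradient_step : ∀ t < T, NotTerminated u ε x y t → ∀ i,
    IsProjection (simplex (A i))
      (x t i - η • (gradient (fun w => payoff u w (y' (t + 1))) (x t)) i) (x (t + 1) i)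
  extend : ∀ t < T, NotTerminated u ε x y t → IsExtendNE u (x (t + 1)) (y (t + 1))

/-- The maximum absolute value `V` of an entry of the payoff tensor. -/
def maxPayoff (u : (∀ i, A i) → B → ℝ) : ℝ :=
  ⨆ s : (∀ i, A i) × B, |u s.1 s.2|

/-- The value `P(Γ) = P(∑ i, |A i|, |B|, V)` of a polynomial with natural coefficients. -/
def polyOfGame (P : MvPolynomial (Fin 3) ℕ) (u : (∀ i, A i) → B → ℝ) : ℝ :=
  MvPolynomial.aeval
    (![((∑ i, Fintype.card (A i) : ℕ) : ℝ), (Fintype.card B : ℝ), maxPayoff u] : Fin 3 → ℝ) P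

end

end TeamGame

namespace TeamGame

noncomputable section

variable {n : ℕ} {A : Fin n → Type*} {B : Type*} [∀ i, Fintype (A i)] [Fintype B]

/-! The potential is an approximate Moreau envelope of `phi`. Smoothness makes `U(·, y)` weakly
convex (`IsSmooth.payoff_ge`), so `U(q, y) + ℓ‖x - q‖²` is convex in `q` and linear in `y`. Sion's
theorem gives it a saddle point `(p, y₀)` (`IsSmooth.exists_saddle`), and `p` is an exact proximal
point of `x`. Everything depends on `r = ℓ‖x - p‖`.

If `r` is small, `y₀` together with `z i = φ(x) - 6r` is feasible for the linear program. An optimal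
solution then has `∑ z i ≥ n(φ(x) - 6r)`, while every `z i` is at most `U(x, y) ≤ φ(x)`; hence each
`z i` is within `6nr` of `φ(x)`, which makes `(x, y)` a `6nr`-equilibrium
(`isApproxNash_of_saddle`).

If no equilibrium was found, then `r > ε/(6n)`. A projected gradient step against a best response
reduces `‖x - p‖²` by `2ηℓ‖x - p‖²` up to an error `η²‖∇U‖²` (`norm_sq_step_le_of_saddle`). Using
`p` as a competitor in the proximal problem of the new iterate turns this into a decrease of the
potential by `2ηr²` minus errors (`potential_step_lt`). With `η = cε²` and small `c` the decrease is
of order `cε⁴`, and boundedness of the potential limits the number of steps. -/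

/-! ### Multilinearity of the payoff and its gradients. -/

/-- The expected payoff against a fixed adversary strategy, as a multilinear map of the team. -/
def teamMultilinear (u : (∀ i, A i) → B → ℝ) (y : AdvVec B) :
    ContinuousMultilinearMap ℝ (fun i => EuclideanSpace ℝ (A i)) ℝ :=
  ∑ a : (∀ i, A i), (∑ b : B, y b * u a b) •
    (ContinuousMultilinearMap.mkPiAlgebra ℝ (Fin n) ℝ).compContinuousLinearMap
      (fun i => (EuclideanSpace.proj (a i) : EuclideanSpace ℝ (A i) →L[ℝ] ℝ))

lemma payoff_eq_teamMultilinear (u : (∀ i, A i) → B → ℝ) (x : TeamVec A) (y : AdvVec B) :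
    payoff u x y = teamMultilinear u y x.ofLp := by
  rw [payoff, teamMultilinear, sum_apply]
  refine Finset.sum_congr rfl fun a _ => ?_
  rw [smul_apply, smul_eq_mul, ContinuousMultilinearMap.compContinuousLinearMap_apply,
    ContinuousMultilinearMap.mkPiAlgebra_apply, Finset.sum_mul]
  refine Finset.sum_congr rfl fun b _ => ?_
  simp only [PiLp.proj_apply]
  ring

lemma payoff_deviate (u : (∀ i, A i) → B → ℝ) (x : TeamVec A) (y : AdvVec B) (i : Fin n)
    (v : EuclideanSpace ℝ (A i)) :
    payoff u (deviate x i v) y = teamMultilinear u y (Function.update x.ofLp i v) := by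
  rw [payoff_eq_teamMultilinear]; rfl

lemma sum_smul_pureStrategy {S : Type*} [Fintype S] (v : EuclideanSpace ℝ S) :
    ∑ s, v s • (pureStrategy s : EuclideanSpace ℝ S) = v := by
  classical
  ext t
  simp [pureStrategy, Pi.single_apply]

lemma pureStrategy_mem_simplex {S : Type*} [Fintype S] (s : S) :
    (pureStrategy s : EuclideanSpace ℝ S) ∈ simplex S := by
  classical
  have := single_mem_stdSimplex ℝ s
  simpa [simplex, pureStrategy] using this

lemma payoff_deviate_eq_sum (u : (∀ i, A i) → B → ℝ) (x : TeamVec A) (y : AdvVec B) (i : Fin n)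
    (v : EuclideanSpace ℝ (A i)) :
    payoff u (deviate x i v) y = ∑ a, v a * payoff u (deviate x i (pureStrategy a)) y := by
  classical
  conv_lhs => rw [← sum_smul_pureStrategy v, payoff_deviate,
    ← ContinuousMultilinearMap.coe_coe, MultilinearMap.map_update_sum]
  exact Finset.sum_congr rfl fun a _ => by
    rw [MultilinearMap.map_update_smul, payoff_deviate, smul_eq_mul,
      ContinuousMultilinearMap.coe_coe]

lemma deviate_self (x : TeamVec A) (i : Fin n) : deviate x i (x i) = x := by
  simp [deviate]

lemma payoff_eq_sum_pure (u : (∀ i, A i) → B → ℝ) (x : TeamVec A) (y : AdvVec B) :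
    payoff u x y = ∑ b, y b * payoff u x (pureStrategy b) := by
  classical
  have h : ∀ b, payoff u x (pureStrategy b) = ∑ a : (∀ i, A i), (∏ i, x i (a i)) * u a b := by
    intro b
    refine Finset.sum_congr rfl fun a _ => ?_
    rw [Finset.sum_eq_single b] <;>
      simp +contextual [pureStrategy]
  simp only [h]
  rw [payoff, Finset.sum_comm]
  refine Finset.sum_congr rfl fun b _ => ?_
  rw [Finset.mul_sum]
  exact Finset.sum_congr rfl fun a _ => by ring

/-- The gradient of the payoff in the team's strategies. -/
def teamGrad (u : (∀ i, A i) → B → ℝ) (x : TeamVec A) (y : AdvVec B) : TeamVec A :=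
  WithLp.toLp 2 fun i => WithLp.toLp 2 fun a => payoff u (deviate x i (pureStrategy a)) y

/-- The gradient of the payoff in the adversary's strategy. -/
def advGrad (u : (∀ i, A i) → B → ℝ) (x : TeamVec A) : AdvVec B :=
  WithLp.toLp 2 fun b => payoff u x (pureStrategy b)

lemma inner_teamGrad (u : (∀ i, A i) → B → ℝ) (x h : TeamVec A) (y : AdvVec B) :
    inner ℝ (teamGrad u x y) h = ∑ i, payoff u (deviate x i (h i)) y := by
  rw [PiLp.inner_apply]
  refine Finset.sum_congr rfl fun i _ => ?_
  rw [payoff_deviate_eq_sum, PiLp.inner_apply]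
  exact Finset.sum_congr rfl fun a _ => by simp [teamGrad]

lemma inner_advGrad (u : (∀ i, A i) → B → ℝ) (x : TeamVec A) (y : AdvVec B) :
    inner ℝ (advGrad u x) y = payoff u x y := by
  rw [payoff_eq_sum_pure, PiLp.inner_apply]
  exact Finset.sum_congr rfl fun b _ => by simp [advGrad]

lemma hasGradientAt_payoff_team (u : (∀ i, A i) → B → ℝ) (x : TeamVec A) (y : AdvVec B) :
    HasGradientAt (fun w => payoff u w y) (teamGrad u x y) x := by
  rw [hasGradientAt_iff_hasFDerivAt]
  have h := ((teamMultilinear u y).hasFDerivAt (x := x.ofLp)).comp x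
    (PiLp.continuousLinearEquiv 2 ℝ (fun i => EuclideanSpace ℝ (A i))).hasFDerivAt
  have e : (fun w => payoff u w y) = (teamMultilinear u y) ∘
      (PiLp.continuousLinearEquiv 2 ℝ (fun i => EuclideanSpace ℝ (A i))) := by
    funext w; exact payoff_eq_teamMultilinear u w y
  rw [e]
  refine h.congr_fderiv ?_
  ext w
  simp only [ContinuousLinearMap.comp_apply, InnerProductSpace.toDual_apply_apply,
    inner_teamGrad, payoff_deviate]
  simp

lemma hasGradientAt_payoff (u : (∀ i, A i) → B → ℝ) (z : WithLp 2 (TeamVec A × AdvVec B)) :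
    HasGradientAt (fun w : WithLp 2 (TeamVec A × AdvVec B) => payoff u w.fst w.snd)
      (WithLp.toLp 2 (teamGrad u z.fst z.snd, advGrad u z.fst)) z := by
  rw [hasGradientAt_iff_hasFDerivAt]
  have h1 : HasFDerivAt (fun w : WithLp 2 (TeamVec A × AdvVec B) => w.fst)
      (WithLp.fstL 2 ℝ (TeamVec A) (AdvVec B)) z := (WithLp.fstL 2 ℝ _ _).hasFDerivAt
  have h2 : ∀ b, HasFDerivAt (fun w : WithLp 2 (TeamVec A × AdvVec B) => w.snd b)
      ((EuclideanSpace.proj b).comp (WithLp.sndL 2 ℝ (TeamVec A) (AdvVec B))) z := fun b =>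
    ((EuclideanSpace.proj b).comp (WithLp.sndL 2 ℝ (TeamVec A) (AdvVec B))).hasFDerivAt
  have h3 : ∀ b, HasFDerivAt
      (fun w : WithLp 2 (TeamVec A × AdvVec B) => payoff u w.fst (pureStrategy b)) _ z :=
    fun b => (hasGradientAt_payoff_team u z.fst (pureStrategy b)).hasFDerivAt.comp z h1
  have h := HasFDerivAt.fun_sum (u := Finset.univ) fun b _ => (h2 b).mul (h3 b)
  have e : (fun w : WithLp 2 (TeamVec A × AdvVec B) => payoff u w.fst w.snd) =
      fun w => ∑ b, w.snd b * payoff u w.fst (pureStrategy b) := by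
    funext w; exact payoff_eq_sum_pure _ _ _
  rw [e]
  refine h.congr_fderiv ?_
  ext w
  simp only [InnerProductSpace.toDual_apply_apply, WithLp.prod_inner_apply,
    sum_apply, add_apply, smul_apply, ContinuousLinearMap.comp_apply, smul_eq_mul,
    Finset.sum_add_distrib]
  congr 1
  · simp only [WithLp.fstL_apply, inner_teamGrad, Finset.mul_sum]
    rw [Finset.sum_comm]
    exact Finset.sum_congr rfl fun i _ => (payoff_eq_sum_pure _ _ _).symm
  · rw [inner_advGrad, payoff_eq_sum_pure]
    exact Finset.sum_congr rfl fun b _ => by simp [mul_comm]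

/-! ### Strategy sets and elementary bounds. -/

lemma simplex_nonempty (S : Type*) [Fintype S] [Nonempty S] : (simplex S).Nonempty :=
  ⟨_, pureStrategy_mem_simplex (Classical.arbitrary S)⟩

lemma simplex_eq_preimage (S : Type*) [Fintype S] :
    simplex S = (EuclideanSpace.equiv S ℝ) ⁻¹' stdSimplex ℝ S := rfl

lemma convex_simplex (S : Type*) [Fintype S] : Convex ℝ (simplex S) := by
  rw [simplex_eq_preimage]
  exact (convex_stdSimplex ℝ S).linear_preimage
    (EuclideanSpace.equiv S ℝ).toLinearEquiv.toLinearMap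

lemma isCompact_simplex (S : Type*) [Fintype S] : IsCompact (simplex S) := by
  rw [simplex_eq_preimage]
  exact (EuclideanSpace.equiv S ℝ).toHomeomorph.isCompact_preimage.mpr (isCompact_stdSimplex ℝ S)

lemma norm_le_one_of_mem_simplex {S : Type*} [Fintype S] {v : EuclideanSpace ℝ S}
    (hv : v ∈ simplex S) : ‖v‖ ≤ 1 := by
  have h : ‖v‖ ^ 2 ≤ 1 := by
    rw [EuclideanSpace.real_norm_sq_eq, ← hv.2]
    refine Finset.sum_le_sum fun s _ => ?_
    have h1 := mem_Icc_of_mem_stdSimplex hv s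
    nlinarith [h1.1, h1.2]
  nlinarith [norm_nonneg v]

lemma convex_teamStrategies : Convex ℝ (teamStrategies A) := by
  intro x hx y hy a b ha hb hab i
  exact convex_simplex _ (hx i) (hy i) ha hb hab

lemma isCompact_teamStrategies : IsCompact (teamStrategies A) := by
  have h : teamStrategies A = (PiLp.continuousLinearEquiv 2 ℝ
      (fun i => EuclideanSpace ℝ (A i))) ⁻¹' (Set.univ.pi fun i => simplex (A i)) := by
    ext x; simp [teamStrategies]
  rw [h]
  exact (PiLp.continuousLinearEquiv 2 ℝ _).toHomeomorph.isCompact_preimage.mpr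
    (isCompact_univ_pi fun i => isCompact_simplex _)

lemma teamStrategies_nonempty [∀ i, Nonempty (A i)] : (teamStrategies A).Nonempty :=
  ⟨WithLp.toLp 2 fun i => pureStrategy (Classical.arbitrary (A i)),
    fun _ => pureStrategy_mem_simplex _⟩

lemma deviate_mem {x : TeamVec A} (hx : x ∈ teamStrategies A) {i : Fin n}
    {v : EuclideanSpace ℝ (A i)} (hv : v ∈ simplex (A i)) : deviate x i v ∈ teamStrategies A := by
  intro j
  by_cases h : j = i
  · subst h; simpa [deviate] using hv
  · simpa [deviate, h] using hx j

lemma deviate_sub (x : TeamVec A) (i : Fin n) (v : EuclideanSpace ℝ (A i)) :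
    deviate x i v - x = PiLp.single 2 i (v - x i) := by
  ext j a
  by_cases h : j = i
  · subst h; simp [deviate]
  · simp [deviate, h]

lemma norm_deviate_sub_deviate_le (x x' : TeamVec A) (i : Fin n) (v : EuclideanSpace ℝ (A i)) :
    ‖deviate x i v - deviate x' i v‖ ≤ ‖x - x'‖ := by
  refine le_of_sq_le_sq ?_ (norm_nonneg _)
  rw [PiLp.norm_sq_eq_of_L2, PiLp.norm_sq_eq_of_L2]
  refine Finset.sum_le_sum fun j _ => ?_
  by_cases h : j = i
  · subst h; simp [deviate]
  · simp [deviate, h]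

lemma norm_le_sum_norm {ι : Type*} [Fintype ι] {E : ι → Type*} [∀ i, NormedAddCommGroup (E i)]
    (x : PiLp 2 E) : ‖x‖ ≤ ∑ i, ‖x i‖ := by
  refine le_of_sq_le_sq ?_ (Finset.sum_nonneg fun i _ => norm_nonneg _)
  rw [PiLp.norm_sq_eq_of_L2]
  exact Finset.sum_sq_le_sq_sum_of_nonneg fun i _ => norm_nonneg _

lemma norm_le_card_mul {S : Type*} [Fintype S] {v : EuclideanSpace ℝ S} {K : ℝ}
    (h : ∀ s, |v s| ≤ K) : ‖v‖ ≤ Fintype.card S * K := by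
  refine (norm_le_sum_norm v).trans ?_
  refine (Finset.sum_le_sum fun s _ => h s).trans ?_
  simp

lemma norm_teamVec_le {w : TeamVec A} {K : ℝ} (h : ∀ i a, |w i a| ≤ K) :
    ‖w‖ ≤ (∑ i, Fintype.card (A i) : ℕ) * K := by
  refine (norm_le_sum_norm w).trans ?_
  refine (Finset.sum_le_sum fun i _ => norm_le_card_mul (h i)).trans ?_
  rw [← Finset.sum_mul]; push_cast; rfl

lemma abs_le_maxPayoff (u : (∀ i, A i) → B → ℝ) (a : ∀ i, A i) (b : B) :
    |u a b| ≤ maxPayoff u :=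
  le_ciSup (f := fun s : (∀ i, A i) × B => |u s.1 s.2|) (Set.finite_range _).bddAbove (a, b)

lemma maxPayoff_nonneg {n : ℕ} {A : Fin n → Type*} {B : Type*} (u : (∀ i, A i) → B → ℝ) : 0 ≤ maxPayoff u :=
  Real.iSup_nonneg fun _ => abs_nonneg _

lemma abs_payoff_le (u : (∀ i, A i) → B → ℝ) {x : TeamVec A} {y : AdvVec B}
    (hx : x ∈ teamStrategies A) (hy : y ∈ simplex B) : |payoff u x y| ≤ maxPayoff u := by
  classical
  have hx0 : ∀ a : (∀ i, A i), 0 ≤ ∏ i, x i (a i) :=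
    fun a => Finset.prod_nonneg fun i _ => (hx i).1 _
  have hx1 : ∑ a : (∀ i, A i), ∏ i, x i (a i) = 1 := by
    rw [← Fintype.prod_sum (fun i a => x i a)]
    exact Finset.prod_eq_one fun i _ => (hx i).2
  calc |payoff u x y|
      ≤ ∑ a : (∀ i, A i), ∑ b : B, (∏ i, x i (a i)) * y b * maxPayoff u := by
        refine (Finset.abs_sum_le_sum_abs _ _).trans (Finset.sum_le_sum fun a _ => ?_)
        refine (Finset.abs_sum_le_sum_abs _ _).trans (Finset.sum_le_sum fun b _ => ?_)
        have h0 := mul_nonneg (hx0 a) (hy.1 b)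
        rw [abs_mul, abs_of_nonneg h0]
        exact mul_le_mul_of_nonneg_left (abs_le_maxPayoff u a b) h0
    _ = maxPayoff u := by
        simp_rw [← Finset.sum_mul, ← Finset.mul_sum]
        rw [show ∑ b, y b = 1 from hy.2]
        simp [hx1]

lemma bddAbove_payoff (u : (∀ i, A i) → B → ℝ) {x : TeamVec A} (hx : x ∈ teamStrategies A) :
    BddAbove ((fun y => payoff u x y) '' simplex B) := by
  refine ⟨maxPayoff u, ?_⟩
  rintro _ ⟨y, hy, rfl⟩
  exact (abs_le.mp (abs_payoff_le u hx hy)).2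

lemma payoff_le_phi (u : (∀ i, A i) → B → ℝ) {x : TeamVec A} {y : AdvVec B}
    (hx : x ∈ teamStrategies A) (hy : y ∈ simplex B) : payoff u x y ≤ phi u x :=
  le_csSup (bddAbove_payoff u hx) ⟨y, hy, rfl⟩

lemma phi_le [Nonempty B] {u : (∀ i, A i) → B → ℝ} {x : TeamVec A} {C : ℝ}
    (h : ∀ y ∈ simplex B, payoff u x y ≤ C) : phi u x ≤ C := by
  refine csSup_le ((simplex_nonempty B).image _) ?_
  rintro _ ⟨y, hy, rfl⟩
  exact h y hy

lemma abs_phi_le [Nonempty B] (u : (∀ i, A i) → B → ℝ) {x : TeamVec A}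
    (hx : x ∈ teamStrategies A) : |phi u x| ≤ maxPayoff u := by
  obtain ⟨y, hy⟩ := simplex_nonempty B
  have h1 := payoff_le_phi u hx hy
  have h2 := (abs_le.mp (abs_payoff_le u hx hy)).1
  exact abs_le.mpr ⟨h2.trans h1, phi_le fun y hy => (abs_le.mp (abs_payoff_le u hx hy)).2⟩

lemma norm_sub_sq_le_of_mem {x p : TeamVec A} (hx : x ∈ teamStrategies A)
    (hp : p ∈ teamStrategies A) : ‖x - p‖ ^ 2 ≤ 4 * n := by
  rw [PiLp.norm_sq_eq_of_L2]
  have h : ∀ i, ‖(x - p) i‖ ^ 2 ≤ 4 := by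
    intro i
    have h1 : ‖(x - p) i‖ ≤ 2 := by
      have := norm_sub_le (x i) (p i)
      have h2 := norm_le_one_of_mem_simplex (hx i)
      have h3 := norm_le_one_of_mem_simplex (hp i)
      simp only [PiLp.sub_apply]; linarith
    nlinarith [norm_nonneg ((x - p) i)]
  refine (Finset.sum_le_sum fun i _ => h i).trans ?_
  simp [mul_comm]

lemma le_sum_card [∀ i, Nonempty (A i)] : n ≤ ∑ i, Fintype.card (A i) := by
  calc n = ∑ _i : Fin n, 1 := by simp
    _ ≤ _ := Finset.sum_le_sum fun i _ => Fintype.card_pos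

lemma norm_teamGrad_le (u : (∀ i, A i) → B → ℝ) {x : TeamVec A} {y : AdvVec B}
    (hx : x ∈ teamStrategies A) (hy : y ∈ simplex B) :
    ‖teamGrad u x y‖ ≤ (∑ i, Fintype.card (A i) : ℕ) * maxPayoff u :=
  norm_teamVec_le fun _ _ => abs_payoff_le u (deviate_mem hx (pureStrategy_mem_simplex _)) hy

lemma norm_toLp_prod_le (v : TeamVec A) (w : AdvVec B) :
    ‖(WithLp.toLp 2 (v, w) : WithLp 2 (TeamVec A × AdvVec B))‖ ≤ ‖v‖ + ‖w‖ := by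
  refine le_of_sq_le_sq ?_ (by positivity)
  rw [WithLp.prod_norm_sq_eq_of_L2]
  change ‖v‖ ^ 2 + ‖w‖ ^ 2 ≤ _
  nlinarith [norm_nonneg v, norm_nonneg w]

lemma norm_fst_le (z : WithLp 2 (TeamVec A × AdvVec B)) : ‖z.fst‖ ≤ ‖z‖ := by
  refine le_of_sq_le_sq ?_ (norm_nonneg _)
  rw [WithLp.prod_norm_sq_eq_of_L2]
  nlinarith [norm_nonneg z.snd]

lemma norm_snd_le (z : WithLp 2 (TeamVec A × AdvVec B)) : ‖z.snd‖ ≤ ‖z‖ := by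
  refine le_of_sq_le_sq ?_ (norm_nonneg _)
  rw [WithLp.prod_norm_sq_eq_of_L2]
  nlinarith [norm_nonneg z.fst]

/-! ### Smoothness and weak convexity. -/

lemma abs_payoff_sub_le (u : (∀ i, A i) → B → ℝ) {z z' : WithLp 2 (TeamVec A × AdvVec B)}
    (hz1 : z.fst ∈ teamStrategies A) (hz2 : z.snd ∈ simplex B)
    (hz1' : z'.fst ∈ teamStrategies A) (hz2' : z'.snd ∈ simplex B) :
    |payoff u z.fst z.snd - payoff u z'.fst z'.snd| ≤
      ((∑ i, Fintype.card (A i) : ℕ) + Fintype.card B) * maxPayoff u * ‖z - z'‖ := by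
  set s : Set (WithLp 2 (TeamVec A × AdvVec B)) :=
    {z | z.fst ∈ teamStrategies A ∧ z.snd ∈ simplex B}
  have hs : Convex ℝ s := fun x hx y hy a b ha hb hab =>
    ⟨convex_teamStrategies hx.1 hy.1 ha hb hab, convex_simplex _ hx.2 hy.2 ha hb hab⟩
  refine hs.norm_image_sub_le_of_norm_hasFDerivWithin_le
    (f := fun w : WithLp 2 (TeamVec A × AdvVec B) => payoff u w.fst w.snd)
    (fun w _ => (hasGradientAt_payoff u w).hasFDerivAt.hasFDerivWithinAt) ?_
    ⟨hz1', hz2'⟩ ⟨hz1, hz2⟩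
  intro w hw
  rw [LinearIsometryEquiv.norm_map]
  refine (norm_toLp_prod_le _ _).trans ?_
  rw [add_mul]
  exact add_le_add (norm_teamGrad_le u hw.1 hw.2)
    (norm_le_card_mul fun b => abs_payoff_le u hw.1 (pureStrategy_mem_simplex _))

lemma isSmooth_iff (u : (∀ i, A i) → B → ℝ) (l : ℝ) : IsSmooth u l ↔
    ∀ x ∈ teamStrategies A, ∀ y ∈ simplex B, ∀ x' ∈ teamStrategies A, ∀ y' ∈ simplex B,
      ‖(WithLp.toLp 2 (teamGrad u x y - teamGrad u x' y', advGrad u x - advGrad u x') :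
        WithLp 2 (TeamVec A × AdvVec B))‖
      ≤ l * ‖(WithLp.toLp 2 (x - x', y - y') : WithLp 2 (TeamVec A × AdvVec B))‖ := by
  constructor
  · intro h x hx y hy x' hx' y' hy'
    have := h (WithLp.toLp 2 (x, y)) (WithLp.toLp 2 (x', y')) hx hy hx' hy'
    rwa [(hasGradientAt_payoff u _).gradient, (hasGradientAt_payoff u _).gradient] at this
  · intro h z z' h1 h2 h3 h4
    rw [(hasGradientAt_payoff u _).gradient, (hasGradientAt_payoff u _).gradient]
    exact h _ h1 _ h2 _ h3 _ h4

/-- The payoff is smooth with a parameter polynomial in the size of the game. -/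
lemma isSmooth_of_size (u : (∀ i, A i) → B → ℝ) :
    IsSmooth u (maxPayoff u *
      ((∑ i, Fintype.card (A i) : ℕ) + Fintype.card B) ^ 2 + 1) := by
  rw [isSmooth_iff]
  intro x hx y hy x' hx' y' hy'
  set N : ℝ := ((∑ i, Fintype.card (A i) : ℕ) : ℝ) with hN
  set M : ℝ := (Fintype.card B : ℝ) with hM
  set V := maxPayoff u with hV
  have hV0 : 0 ≤ V := maxPayoff_nonneg u
  have hN0 : 0 ≤ N := by positivity
  have hM0 : 0 ≤ M := by positivity
  set d := ‖(WithLp.toLp 2 (x - x', y - y') : WithLp 2 (TeamVec A × AdvVec B))‖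
  have hd0 : 0 ≤ d := norm_nonneg _
  set K := (N + M) * V * d
  -- Each gradient coordinate is itself a payoff at a profile with one pure strategy, so the
  -- Lipschitz bound for payoffs applies to it. Summing over the `N + M` coordinates gives the
  -- second factor `N + M`.
  have h1 : ∀ i a, |(teamGrad u x y - teamGrad u x' y') i a| ≤ K := by
    intro i a
    have hp := pureStrategy_mem_simplex a
    refine (abs_payoff_sub_le u (z := WithLp.toLp 2 (deviate x i (pureStrategy a), y))
      (z' := WithLp.toLp 2 (deviate x' i (pureStrategy a), y'))
      (deviate_mem hx hp) hy (deviate_mem hx' hp) hy').trans ?_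
    refine mul_le_mul_of_nonneg_left ?_ (by positivity)
    refine le_of_sq_le_sq ?_ hd0
    rw [WithLp.prod_norm_sq_eq_of_L2, WithLp.prod_norm_sq_eq_of_L2]
    have := norm_deviate_sub_deviate_le x x' i (pureStrategy a)
    refine add_le_add (pow_le_pow_left₀ (norm_nonneg _) this 2) le_rfl
  have h2 : ∀ b, |(advGrad u x - advGrad u x') b| ≤ K := by
    intro b
    have hp := pureStrategy_mem_simplex b
    refine (abs_payoff_sub_le u (z := WithLp.toLp 2 (x, pureStrategy b))
      (z' := WithLp.toLp 2 (x', pureStrategy b)) hx hp hx' hp).trans ?_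
    refine mul_le_mul_of_nonneg_left ?_ (by positivity)
    refine le_of_sq_le_sq ?_ hd0
    rw [WithLp.prod_norm_sq_eq_of_L2, WithLp.prod_norm_sq_eq_of_L2]
    refine add_le_add le_rfl ?_
    simp
  calc _ ≤ N * K + M * K :=
        (norm_toLp_prod_le _ _).trans (add_le_add (norm_teamVec_le h1) (norm_le_card_mul h2))
    _ = V * (N + M) ^ 2 * d := by simp only [K]; ring
    _ ≤ _ := by nlinarith

lemma IsSmooth.norm_teamGrad_sub_le {u : (∀ i, A i) → B → ℝ} {l : ℝ} (h : IsSmooth u l)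
    {x x' : TeamVec A} {y : AdvVec B} (hx : x ∈ teamStrategies A) (hx' : x' ∈ teamStrategies A)
    (hy : y ∈ simplex B) : ‖teamGrad u x y - teamGrad u x' y‖ ≤ l * ‖x - x'‖ := by
  have h1 := (norm_fst_le _).trans ((isSmooth_iff u l).mp h x hx y hy x' hx' y hy)
  rw [sub_self y] at h1
  refine h1.trans_eq ?_
  rw [WithLp.norm_toLp_fst]

/-- Linearity in `y` gives `U(x, y) = ⟨advGrad x, y⟩` with `‖y‖ ≤ 1`, so the Lipschitz bound on the
adversary's block of the gradient already controls the payoff. -/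
lemma IsSmooth.abs_payoff_sub_le {u : (∀ i, A i) → B → ℝ} {l : ℝ} (h : IsSmooth u l)
    {x x' : TeamVec A} {y : AdvVec B} (hx : x ∈ teamStrategies A) (hx' : x' ∈ teamStrategies A)
    (hy : y ∈ simplex B) : |payoff u x y - payoff u x' y| ≤ l * ‖x - x'‖ := by
  have h1 := (norm_snd_le _).trans ((isSmooth_iff u l).mp h x hx y hy x' hx' y hy)
  rw [sub_self y, WithLp.norm_toLp_fst] at h1
  rw [← inner_advGrad, ← inner_advGrad, ← inner_sub_left]
  refine (abs_real_inner_le_norm _ _).trans ?_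
  calc _ ≤ ‖advGrad u x - advGrad u x'‖ * 1 :=
        mul_le_mul_of_nonneg_left (norm_le_one_of_mem_simplex hy) (norm_nonneg _)
    _ ≤ _ := by rw [mul_one]; exact h1

lemma hasDerivAt_payoff_line (u : (∀ i, A i) → B → ℝ) (x d : TeamVec A) (y : AdvVec B) (t : ℝ) :
    HasDerivAt (fun t : ℝ => payoff u (x + t • d) y)
      (inner ℝ (teamGrad u (x + t • d) y) d) t := by
  have h1 : HasDerivAt (fun t : ℝ => x + t • d) d t := by
    simpa using ((hasDerivAt_id t).smul_const d).const_add x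
  exact (hasGradientAt_payoff_team u (x + t • d) y).hasFDerivAt.comp_hasDerivAt t h1

/-- Weak convexity of a smooth payoff in the team's strategies. -/
lemma IsSmooth.payoff_ge {u : (∀ i, A i) → B → ℝ} {l : ℝ} (h : IsSmooth u l)
    {x p : TeamVec A} {y : AdvVec B} (hx : x ∈ teamStrategies A) (hp : p ∈ teamStrategies A)
    (hy : y ∈ simplex B) :
    payoff u x y + inner ℝ (teamGrad u x y) (p - x) - l / 2 * ‖p - x‖ ^ 2 ≤ payoff u p y := by
  set d := p - x with hd
  set f : ℝ → ℝ := fun t => payoff u (x + t • d) y - t * inner ℝ (teamGrad u x y) d +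
    -- The quadratic term compensates the largest possible drop of the directional derivative, so
    -- `f` is monotone on `[0, 1]`; the claim is `f 0 ≤ f 1`.
    l / 2 * ‖d‖ ^ 2 * t ^ 2 with hf
  have hderiv : ∀ t : ℝ, HasDerivAt f (inner ℝ (teamGrad u (x + t • d) y) d -
      inner ℝ (teamGrad u x y) d + l * ‖d‖ ^ 2 * t) t := by
    intro t
    have := ((hasDerivAt_payoff_line u x d y t).sub
      ((hasDerivAt_id t).mul_const (inner ℝ (teamGrad u x y) d))).add
      ((hasDerivAt_pow 2 t).const_mul (l / 2 * ‖d‖ ^ 2))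
    refine this.congr_deriv ?_
    push_cast
    ring
  have hmono : MonotoneOn f (Set.Icc 0 1) := by
    refine monotoneOn_of_deriv_nonneg (convex_Icc 0 1)
      (fun t _ => (hderiv t).continuousAt.continuousWithinAt)
      (fun t _ => (hderiv t).differentiableAt.differentiableWithinAt) ?_
    intro t ht
    rw [interior_Icc] at ht
    rw [(hderiv t).deriv, ← inner_sub_left]
    have hm : x + t • d ∈ teamStrategies A :=
      convex_teamStrategies.add_smul_sub_mem hx hp ⟨ht.1.le, ht.2.le⟩
    have h1 := h.norm_teamGrad_sub_le hm hx hy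
    rw [add_sub_cancel_left, norm_smul, Real.norm_of_nonneg ht.1.le] at h1
    have h2 := (abs_le.mp (abs_real_inner_le_norm
      (teamGrad u (x + t • d) y - teamGrad u x y) d)).1
    nlinarith [mul_le_mul_of_nonneg_right h1 (norm_nonneg d)]
  have h01 := hmono (Set.left_mem_Icc.mpr zero_le_one) (Set.right_mem_Icc.mpr zero_le_one)
    zero_le_one
  have e : x + d = p := by rw [hd]; abel
  simp only [hf, zero_smul, add_zero, one_smul, e] at h01
  linarith

/-! ### Proximal points as saddle points. -/

lemma norm_sub_sq_expand (x q p : TeamVec A) :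
    ‖x - p‖ ^ 2 = ‖x - q‖ ^ 2 + 2 * inner ℝ (q - x) (p - q) + ‖p - q‖ ^ 2 := by
  have e : x - p = (x - q) - (p - q) := by abel
  rw [e, norm_sub_sq_real, ← neg_sub x q, inner_neg_left]
  ring

lemma convexOn_of_subgradient {E : Type*} [NormedAddCommGroup E] [InnerProductSpace ℝ E]
    {s : Set E} (hs : Convex ℝ s) {f : E → ℝ} {g : E → E}
    (h : ∀ x ∈ s, ∀ y ∈ s, f x + inner ℝ (g x) (y - x) ≤ f y) : ConvexOn ℝ s f := by
  refine ⟨hs, fun x hx y hy a b ha hb hab => ?_⟩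
  set z := a • x + b • y with hz
  have hzs : z ∈ s := hs hx hy ha hb hab
  have h1 := mul_le_mul_of_nonneg_left (h z hzs x hx) ha
  have h2 := mul_le_mul_of_nonneg_left (h z hzs y hy) hb
  have h3 : a * inner ℝ (g z) (x - z) + b * inner ℝ (g z) (y - z) = 0 := by
    rw [← inner_smul_right, ← inner_smul_right, ← inner_add_right]
    have : a • (x - z) + b • (y - z) = (a • x + b • y) - (a + b) • z := by
      rw [add_smul]; module
    rw [this, hab, one_smul, hz, sub_self, inner_zero_right]
  simp only [smul_eq_mul]
  calc f z = (a + b) * f z := by rw [hab, one_mul]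
    _ ≤ _ := by nlinarith

lemma continuous_payoff_team (u : (∀ i, A i) → B → ℝ) (y : AdvVec B) :
    Continuous fun x => payoff u x y :=
  continuous_iff_continuousAt.mpr fun x => (hasGradientAt_payoff_team u x y).continuousAt

lemma continuous_payoff_adv (u : (∀ i, A i) → B → ℝ) (x : TeamVec A) :
    Continuous fun y => payoff u x y := by
  simp_rw [← inner_advGrad]
  fun_prop

lemma concaveOn_payoff_adv (u : (∀ i, A i) → B → ℝ) (x : TeamVec A) :
    ConcaveOn ℝ (simplex B) fun y => payoff u x y := by
  refine ⟨convex_simplex B, fun y _ y' _ a b _ _ _ => le_of_eq ?_⟩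
  simp only [← inner_advGrad, inner_add_right, inner_smul_right, smul_eq_mul]

/-- The regularized game `U(q, y) + ℓ ‖x - q‖²` has a saddle point. -/
lemma IsSmooth.exists_saddle [∀ i, Nonempty (A i)] [Nonempty B] {u : (∀ i, A i) → B → ℝ} {l : ℝ}
    (h : IsSmooth u l) (hl : 0 < l) (x : TeamVec A) :
    ∃ p ∈ teamStrategies A, ∃ y ∈ simplex B,
      (∀ y' ∈ simplex B, payoff u p y' ≤ payoff u p y) ∧
      ∀ q ∈ teamStrategies A,
        payoff u p y + l * ‖x - p‖ ^ 2 ≤ payoff u q y + l * ‖x - q‖ ^ 2 := by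
  obtain ⟨p, hp, y, hy, hs⟩ := Sion.exists_isSaddlePointOn
    (X := teamStrategies A) (Y := simplex B)
    (f := fun q y => payoff u q y + l * ‖x - q‖ ^ 2)
    teamStrategies_nonempty convex_teamStrategies isCompact_teamStrategies
    (fun y _ => by
      have := continuous_payoff_team u y
      exact (Continuous.lowerSemicontinuous (by fun_prop)).lowerSemicontinuousOn _)
    (fun y hy => by
      refine ConvexOn.quasiconvexOn (convexOn_of_subgradient convex_teamStrategies
        (g := fun q => teamGrad u q y + (2 * l) • (q - x)) fun q hq q' hq' => ?_)
      -- Weak convexity loses `ℓ/2 ‖q' - q‖²`, the regularizer gains `ℓ‖q' - q‖²`.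
      have h1 := h.payoff_ge hq hq' hy
      have h2 := norm_sub_sq_expand x q q'
      rw [inner_add_left, real_inner_smul_left, h2]
      nlinarith [sq_nonneg ‖q' - q‖])
    (convex_simplex B) (simplex_nonempty B) (isCompact_simplex B)
    (fun q _ => by
      have := continuous_payoff_adv u q
      exact (Continuous.upperSemicontinuous (by fun_prop)).upperSemicontinuousOn _)
    (fun q _ => ((concaveOn_payoff_adv u q).add_const _).quasiconcaveOn)
  refine ⟨p, hp, y, hy, fun y' hy' => ?_, fun q hq => hs q hq y hy⟩
  have := hs p hp y' hy'
  linarith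

lemma inner_ge_of_isMin {u : (∀ i, A i) → B → ℝ} {l : ℝ} {x p : TeamVec A} {y : AdvVec B}
    (hp : p ∈ teamStrategies A)
    (hmin : ∀ q ∈ teamStrategies A,
      payoff u p y + l * ‖x - p‖ ^ 2 ≤ payoff u q y + l * ‖x - q‖ ^ 2)
    {q : TeamVec A} (hq : q ∈ teamStrategies A) :
    0 ≤ inner ℝ (teamGrad u p y) (q - p) + 2 * l * inner ℝ (p - x) (q - p) := by
  set d := q - p
  -- The regularized objective along the segment from `p` to `q`, without the constant `ℓ‖x - p‖²`.
  -- A negative derivative at `0` would contradict minimality for small `t > 0`.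
  set f : ℝ → ℝ := fun t => payoff u (p + t • d) y + l * (2 * inner ℝ (p - x) d * t +
    ‖d‖ ^ 2 * t ^ 2) with hf
  have hderiv : HasDerivAt f
      (inner ℝ (teamGrad u p y) d + 2 * l * inner ℝ (p - x) d) 0 := by
    have := (hasDerivAt_payoff_line u p d y 0).add
      ((((hasDerivAt_id (0 : ℝ)).const_mul (2 * inner ℝ (p - x) d)).add
      ((hasDerivAt_pow 2 (0 : ℝ)).const_mul (‖d‖ ^ 2))).const_mul l)
    refine this.congr_deriv ?_
    simp
    ring
  by_contra hneg
  push Not at hneg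
  have hev : ∀ᶠ t in nhdsWithin (0 : ℝ) (Set.Ioi 0), f t < f 0 := by
    have h1 := (hasDerivWithinAt_iff_tendsto_slope' (by simp)).mp
      (hderiv.hasDerivWithinAt (s := Set.Ioi 0)) |>.eventually (gt_mem_nhds hneg)
    filter_upwards [h1, self_mem_nhdsWithin] with t ht ht0
    rw [slope_def_field, sub_zero, div_lt_iff₀ ht0, zero_mul] at ht
    linarith
  have hev2 : ∀ᶠ t in nhdsWithin (0 : ℝ) (Set.Ioi 0), t ∈ Set.Ioo (0 : ℝ) 1 :=
    Ioo_mem_nhdsGT one_pos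
  obtain ⟨t, ht, ht1⟩ := (hev.and hev2).exists
  have h2 := hmin _ (convex_teamStrategies.add_smul_sub_mem hp hq ⟨ht1.1.le, ht1.2.le⟩)
  have h3 := norm_sub_sq_expand x p (p + t • (q - p))
  rw [add_sub_cancel_left, inner_smul_right, norm_smul, Real.norm_of_nonneg ht1.1.le] at h3
  rw [h3] at h2
  simp only [hf, zero_smul, add_zero] at ht
  nlinarith

/-! ### Projected steps and first-order deviations. -/

lemma IsProjection.norm_sub_le {E : Type*} [NormedAddCommGroup E] [InnerProductSpace ℝ E]
    {s : Set E} (hs : Convex ℝ s) {v p q : E} (h : IsProjection s v p) (hq : q ∈ s) :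
    ‖p - q‖ ≤ ‖v - q‖ := by
  have hinf : ‖v - p‖ = ⨅ w : s, ‖v - w‖ := by
    have : Nonempty s := ⟨⟨q, hq⟩⟩
    refine le_antisymm (le_ciInf fun w => h.2 w w.2) ?_
    exact ciInf_le (f := fun w : s => ‖v - w‖)
      ⟨0, by rintro _ ⟨w, rfl⟩; exact norm_nonneg _⟩ ⟨p, h.1⟩
  have h1 := (norm_eq_iInf_iff_real_inner_le_zero hs h.1).mp hinf q hq
  refine le_of_sq_le_sq ?_ (norm_nonneg _)
  have e : v - q = (v - p) - (q - p) := by abel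
  rw [e, norm_sub_sq_real (v - p), norm_sub_rev p q]
  nlinarith [sq_nonneg ‖v - p‖]

lemma norm_projection_step_le {x p x' g : TeamVec A} {η : ℝ} (hp : p ∈ teamStrategies A)
    (h : ∀ i, IsProjection (simplex (A i)) (x i - η • g i) (x' i)) :
    ‖x' - p‖ ≤ ‖x - η • g - p‖ := by
  refine le_of_sq_le_sq ?_ (norm_nonneg _)
  rw [PiLp.norm_sq_eq_of_L2, PiLp.norm_sq_eq_of_L2]
  exact Finset.sum_le_sum fun i _ =>
    pow_le_pow_left₀ (norm_nonneg _) ((h i).norm_sub_le (convex_simplex _) (hp i)) 2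

/-- The payoff is affine in each single player's strategy, so first-order optimality translates
exactly into unilateral deviation gains. -/
lemma inner_teamGrad_deviate_sub (u : (∀ i, A i) → B → ℝ) (x : TeamVec A) (y : AdvVec B)
    (i : Fin n) (v : EuclideanSpace ℝ (A i)) :
    inner ℝ (teamGrad u x y) (deviate x i v - x) = payoff u (deviate x i v) y - payoff u x y := by
  rw [inner_teamGrad, deviate_sub, Finset.sum_eq_single i]
  · conv_rhs => rw [← deviate_self x i]
    simp only [PiLp.single_eq_same, payoff_deviate]
    rw [ContinuousMultilinearMap.map_update_sub]
    simp [deviate]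
  · intro j _ hj
    rw [payoff_deviate]
    simp only [PiLp.single_eq_of_ne 2 hj, ← ContinuousMultilinearMap.coe_coe,
      MultilinearMap.map_update_zero]
  · simp

/-! ### Equilibria near the proximal point, and progress towards it. -/

section Saddle

variable {u : (∀ i, A i) → B → ℝ} {l : ℝ} {x p : TeamVec A} {y₀ : AdvVec B}

lemma phi_le_add_of_saddle [Nonempty B] (h : IsSmooth u l) (hx : x ∈ teamStrategies A)
    (hp : p ∈ teamStrategies A) (hbr : ∀ y ∈ simplex B, payoff u p y ≤ payoff u p y₀) :
    phi u x ≤ payoff u p y₀ + l * ‖x - p‖ :=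
  phi_le fun y hy => by
    linarith [(abs_le.mp (h.abs_payoff_sub_le hx hp hy)).2, hbr y hy]

/-- The factor `6` is `1 + 4 + 1`: one unit for replacing `φ(x)` by `U(p, y₀)`, four from the
first-order condition at `p` (factor `2ℓ`, deviation of length at most `2`), one for moving the
deviated profile from `p` back to `x`. -/
lemma payoff_deviate_pure_ge_of_saddle [Nonempty B] (h : IsSmooth u l) (hl : 0 < l)
    (hx : x ∈ teamStrategies A) (hp : p ∈ teamStrategies A) (hy₀ : y₀ ∈ simplex B)
    (hbr : ∀ y ∈ simplex B, payoff u p y ≤ payoff u p y₀)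
    (hmin : ∀ q ∈ teamStrategies A,
      payoff u p y₀ + l * ‖x - p‖ ^ 2 ≤ payoff u q y₀ + l * ‖x - q‖ ^ 2)
    (i : Fin n) (a : A i) :
    phi u x - 6 * (l * ‖x - p‖) ≤ payoff u (deviate x i (pureStrategy a)) y₀ := by
  have ha := pureStrategy_mem_simplex a
  have h1 := phi_le_add_of_saddle h hx hp hbr
  have h2 := inner_ge_of_isMin hp hmin (deviate_mem hp ha)
  rw [inner_teamGrad_deviate_sub] at h2
  have h3 := (abs_le.mp (h.abs_payoff_sub_le (deviate_mem hx ha) (deviate_mem hp ha) hy₀)).1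
  have h4 := mul_le_mul_of_nonneg_left
    (norm_deviate_sub_deviate_le x p i (pureStrategy a)) hl.le
  have h5 : ‖deviate p i (pureStrategy a) - p‖ ≤ 2 := by
    rw [deviate_sub, PiLp.norm_single]
    have := norm_sub_le (pureStrategy a) (p i)
    linarith [norm_le_one_of_mem_simplex ha, norm_le_one_of_mem_simplex (hp i)]
  have h6 := real_inner_le_norm (p - x) (deviate p i (pureStrategy a) - p)
  have h7 : inner ℝ (p - x) (deviate p i (pureStrategy a) - p) ≤ ‖x - p‖ * 2 := by
    rw [norm_sub_rev p x] at h6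
    exact h6.trans (mul_le_mul_of_nonneg_left h5 (norm_nonneg _))
  have h8 := mul_le_mul_of_nonneg_left h7 hl.le
  linarith

/-- If a strategy is close to its proximal point, then it extends to an approximate Nash
equilibrium. -/
lemma isApproxNash_of_saddle [Nonempty B] (h : IsSmooth u l) (hl : 0 < l) (hn : 0 < n)
    (hx : x ∈ teamStrategies A) (hp : p ∈ teamStrategies A) (hy₀ : y₀ ∈ simplex B)
    (hbr : ∀ y ∈ simplex B, payoff u p y ≤ payoff u p y₀)
    (hmin : ∀ q ∈ teamStrategies A,
      payoff u p y₀ + l * ‖x - p‖ ^ 2 ≤ payoff u q y₀ + l * ‖x - q‖ ^ 2)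
    {y : AdvVec B} (hy : IsExtendNE u x y) {ε : ℝ} (hε : 6 * n * (l * ‖x - p‖) ≤ ε) :
    IsApproxNash u ε x y := by
  obtain ⟨z, ⟨hyB, hz⟩, hopt⟩ := hy
  have hfeas : IsDualFeasible u x (fun _ => phi u x - 6 * (l * ‖x - p‖)) y₀ :=
    ⟨hy₀, fun i a => by
      rw [← payoff_eq_sum_pure]
      exact payoff_deviate_pure_ge_of_saddle h hl hx hp hy₀ hbr hmin i a⟩
  have hsum := hopt _ _ hfeas
  have hzv : ∀ i, ∀ v ∈ simplex (A i), z i ≤ payoff u (deviate x i v) y := by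
    intro i v hv
    rw [payoff_deviate_eq_sum]
    calc z i = ∑ a, v a * z i := by rw [← Finset.sum_mul, show ∑ a, v a = 1 from hv.2, one_mul]
      _ ≤ _ := Finset.sum_le_sum fun a _ => mul_le_mul_of_nonneg_left
          ((hz i a).trans_eq (payoff_eq_sum_pure _ _ _).symm) (hv.1 a)
  have hzx : ∀ i, z i ≤ payoff u x y := fun i => by
    have := hzv i (x i) (hx i)
    rwa [deviate_self] at this
  have hzphi : ∀ i, phi u x - ε ≤ z i := by
    intro i
    -- All other `z j` are at most `φ(x)`, so the whole deficit `6nr` of the sum bounds the deficit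
    -- of a single coordinate.
    have h1 : ∑ j, z j ≤ z i + (n - 1) * phi u x := by
      rw [← Finset.add_sum_erase _ _ (Finset.mem_univ i)]
      have h2 : ∑ j ∈ Finset.univ.erase i, z j ≤
          (Finset.univ.erase i).card • phi u x :=
        Finset.sum_le_card_nsmul _ _ _ fun j _ => (hzx j).trans (payoff_le_phi u hx hyB)
      rw [Finset.card_erase_of_mem (Finset.mem_univ i), Finset.card_univ, Fintype.card_fin,
        nsmul_eq_mul, Nat.cast_pred hn] at h2
      linarith
    simp only [Finset.sum_const, Finset.card_univ, Fintype.card_fin, nsmul_eq_mul] at hsum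
    linarith
  refine ⟨hx, hyB, fun i v hv => ?_, fun y' hy' => ?_⟩
  · linarith [hzphi i, hzv i v hv, payoff_le_phi u hx hyB]
  · linarith [hzphi ⟨0, hn⟩, hzx ⟨0, hn⟩, payoff_le_phi u hx hy']

/-- A projected gradient step approaches the proximal point. -/
lemma norm_sq_step_le_of_saddle (h : IsSmooth u l) (hx : x ∈ teamStrategies A)
    (hp : p ∈ teamStrategies A) (hy₀ : y₀ ∈ simplex B)
    (hbr : ∀ y ∈ simplex B, payoff u p y ≤ payoff u p y₀)
    (hmin : ∀ q ∈ teamStrategies A,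
      payoff u p y₀ + l * ‖x - p‖ ^ 2 ≤ payoff u q y₀ + l * ‖x - q‖ ^ 2)
    {y' : AdvVec B} (hy' : IsBestResponse u x y') {η : ℝ} (hη : 0 ≤ η) {x' : TeamVec A}
    (hx' : ∀ i, IsProjection (simplex (A i)) (x i - η • (teamGrad u x y') i) (x' i)) :
    ‖x' - p‖ ^ 2 ≤
      ‖x - p‖ ^ 2 - 2 * η * (l * ‖x - p‖ ^ 2) + η ^ 2 * ‖teamGrad u x y'‖ ^ 2 := by
  have h1 := pow_le_pow_left₀ (norm_nonneg _) (norm_projection_step_le hp hx') 2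
  have e : x - η • teamGrad u x y' - p = (x - p) - η • teamGrad u x y' := by abel
  rw [e, norm_sub_sq_real (x - p), inner_smul_right, norm_smul, mul_pow, Real.norm_eq_abs, sq_abs] at h1
  have h2 := h.payoff_ge hx hp hy'.1
  have h3 := h.payoff_ge hp hx hy₀
  have h4 := inner_ge_of_isMin hp hmin hx
  have h5 := hbr _ hy'.1
  have h6 := hy'.2 _ hy₀
  have e2 : inner ℝ (teamGrad u x y') (p - x) = - inner ℝ (x - p) (teamGrad u x y') := by
    rw [← neg_sub x p, inner_neg_right, real_inner_comm]
  have e3 : inner ℝ (p - x) (x - p) = - ‖x - p‖ ^ 2 := by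
    rw [← neg_sub x p, inner_neg_left, real_inner_self_eq_norm_sq]
  rw [e2, norm_sub_rev p x] at h2
  rw [e3] at h4
  -- The first-order condition at `p` contributes `2ℓ‖x - p‖²`, and the two weak convexity
  -- inequalities cost `ℓ/2 ‖x - p‖²` each. The payoffs cancel because `y₀` is a best response to
  -- `p` and `y'` one to `x`.
  have h7 : l * ‖x - p‖ ^ 2 ≤ inner ℝ (x - p) (teamGrad u x y') := by linarith
  have h8 := mul_le_mul_of_nonneg_left h7 hη
  linarith

end Saddle

/-! ### Decrease and boundedness of the potential. -/

lemma gradient_payoff_team (u : (∀ i, A i) → B → ℝ) (x : TeamVec A) (y : AdvVec B) :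
    gradient (fun w => payoff u w y) x = teamGrad u x y :=
  (hasGradientAt_payoff_team u x y).gradient

/-- One iteration from a strategy that does not extend to an approximate Nash equilibrium
decreases the potential. -/
lemma potential_step_lt [∀ i, Nonempty (A i)] [Nonempty B] {u : (∀ i, A i) → B → ℝ} {l δ : ℝ}
    (h : IsSmooth u l) (hl : 0 < l) (hn : 0 < n) {prox : TeamVec A → TeamVec A}
    (hprox : ∀ x ∈ teamStrategies A, IsApproxProx u l δ x (prox x))
    {x x' : TeamVec A} {y y' : AdvVec B} {ε η : ℝ} (hε : 0 < ε) (hη : 0 < η)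
    (hx : x ∈ teamStrategies A) (hy : IsExtendNE u x y) (hne : ¬ IsApproxNash u ε x y)
    (hy' : IsBestResponse u x y')
    (hx' : ∀ i, IsProjection (simplex (A i))
      (x i - η • (gradient (fun w => payoff u w y') x) i) (x' i)) :
    potential u l prox x' < potential u l prox x - 2 * η * (ε / (6 * n)) ^ 2 +
      l * η ^ 2 * ((∑ i, Fintype.card (A i) : ℕ) * maxPayoff u) ^ 2 + δ := by
  rw [gradient_payoff_team] at hx'
  obtain ⟨p, hp, y₀, hy₀, hbr, hmin⟩ := h.exists_saddle hl x
  have hn' : (0 : ℝ) < n := by exact_mod_cast hn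
  have hr : ε / (6 * n) < l * ‖x - p‖ := by
    by_contra hle
    push Not at hle
    rw [le_div_iff₀ (by positivity)] at hle
    exact hne (isApproxNash_of_saddle h hl hn hx hp hy₀ hbr hmin hy (by linarith))
  have hr2 : (ε / (6 * n)) ^ 2 < (l * ‖x - p‖) ^ 2 :=
    pow_lt_pow_left₀ hr (by positivity) two_ne_zero
  have h1 := norm_sq_step_le_of_saddle h hx hp hy₀ hbr hmin hy' hη.le hx'
  have h2 := pow_le_pow_left₀ (norm_nonneg _) (norm_teamGrad_le u hx hy'.1) 2
  -- The error `δ` enters only here, at the new iterate; at `x` the exact minimality of `p` suffices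
  -- (`h5`, `h6`).
  have h3 := (hprox x' fun i => (hx' i).1).2 p hp
  have h4 : phi u p ≤ payoff u p y₀ := phi_le hbr
  have h5 := hmin _ (hprox x hx).1
  have h6 := payoff_le_phi u (hprox x hx).1 hy₀
  have h7 := mul_le_mul_of_nonneg_left h1 hl.le
  have h8 := mul_le_mul_of_nonneg_left h2 (mul_nonneg hl.le (sq_nonneg η))
  have h9 := mul_lt_mul_of_pos_left hr2 (mul_pos two_pos hη)
  simp only [potential]
  linarith

lemma abs_potential_le [Nonempty B] {u : (∀ i, A i) → B → ℝ} {l δ : ℝ} (hl : 0 ≤ l)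
    {prox : TeamVec A → TeamVec A} {x : TeamVec A} (hx : x ∈ teamStrategies A)
    (hprox : IsApproxProx u l δ x (prox x)) :
    |potential u l prox x| ≤ maxPayoff u + l * (4 * n) := by
  have h1 := abs_le.mp (abs_phi_le u hprox.1)
  have h2 := mul_le_mul_of_nonneg_left (norm_sub_sq_le_of_mem hx hprox.1) hl
  have h3 : 0 ≤ l * ‖x - prox x‖ ^ 2 := by positivity
  have h4 : 0 ≤ l * (4 * n) := by positivity
  simp only [potential]
  exact abs_le.mpr ⟨by linarith, by linarith⟩

/-- Permits the assumption `ε < 2V` in the iteration count, which bounds `cε⁴` by a polynomial of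
the game. -/
lemma isApproxNash_of_two_mul_maxPayoff_le {u : (∀ i, A i) → B → ℝ} {ε : ℝ} {x : TeamVec A}
    {y : AdvVec B} (hx : x ∈ teamStrategies A) (hy : y ∈ simplex B)
    (hε : 2 * maxPayoff u ≤ ε) : IsApproxNash u ε x y := by
  have h := abs_le.mp (abs_payoff_le u hx hy)
  refine ⟨hx, hy, fun i v hv => ?_, fun y' hy' => ?_⟩
  · linarith [(abs_le.mp (abs_payoff_le u (deviate_mem hx hv) hy)).1, h.2]
  · linarith [(abs_le.mp (abs_payoff_le u hx hy')).2, h.1]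

/-! ### Runs, polynomials and constants. -/

section Run

variable {u : (∀ i, A i) → B → ℝ} {ε η : ℝ} {T : ℕ} {x : ℕ → TeamVec A} {y y' : ℕ → AdvVec B}

lemma NotTerminated.mono {s t : ℕ} (h : NotTerminated u ε x y t) (hst : s ≤ t) :
    NotTerminated u ε x y s := fun r hr => h r (hr.trans hst)

lemma IsGDMaxRun.isExtendNE (h : IsGDMaxRun u ε η T x y y') {t : ℕ} (ht : t < T)
    (hnt : NotTerminated u ε x y t) (ht0 : 0 < t) : IsExtendNE u (x t) (y t) := by
  obtain ⟨s, rfl⟩ := Nat.exists_eq_succ_of_ne_zero ht0.ne'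
  exact h.extend s (by omega) (hnt.mono (Nat.le_succ s))

lemma IsGDMaxRun.team_mem (h : IsGDMaxRun u ε η T x y y') {t : ℕ} (ht : t ≤ T)
    (hnt : ∀ s < t, NotTerminated u ε x y s) : x t ∈ teamStrategies A := by
  cases t with
  | zero => exact h.init_team
  | succ s => exact fun i => (h.gradient_step s ht (hnt s (Nat.lt_succ_self s)) i).1

end Run

/-- A bounded sequence decreases by a fixed amount only a bounded number of times. -/
lemma le_of_forall_decrease {g : ℕ → ℝ} {d : ℝ} {m : ℕ}
    (h : ∀ t, 0 < t → t < m + 1 → g (t + 1) ≤ g t - d) : g (m + 1) ≤ g 1 - m * d := by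
  induction m with
  | zero => simp
  | succ k ih =>
    have h1 := ih fun t ht0 ht => h t ht0 (by omega)
    have h2 := h (k + 1) (by omega) (by omega)
    push_cast
    linarith

/-- The polynomial `V + 4 N R`, a bound for the potential. -/
def boundPoly (R : MvPolynomial (Fin 3) ℕ) : MvPolynomial (Fin 3) ℕ :=
  MvPolynomial.X 2 + 4 * MvPolynomial.X 0 * R

/-- The polynomial that controls step size, accuracy, decrease and number of iterations. -/
def ratePoly (R : MvPolynomial (Fin 3) ℕ) : MvPolynomial (Fin 3) ℕ :=
  -- With `N`, `V` the values of `X 0`, `X 2` and `G` that of `boundPoly R`: `1` gives `P ≥ 1`, `G`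
  -- bounds the potential, `72N²` gives the decrease, `36RN⁴V²` makes the squared-gradient error
  -- small, and `144N²G + 32V⁴` pays for the iteration count.
  1 + boundPoly R + 72 * MvPolynomial.X 0 ^ 2 +
    36 * R * MvPolynomial.X 0 ^ 4 * MvPolynomial.X 2 ^ 2 +
    144 * MvPolynomial.X 0 ^ 2 * boundPoly R + 32 * MvPolynomial.X 2 ^ 4

lemma polyOfGame_boundPoly (R : MvPolynomial (Fin 3) ℕ) (u : (∀ i, A i) → B → ℝ) :
    polyOfGame (boundPoly R) u = maxPayoff u +
      4 * (∑ i, Fintype.card (A i) : ℕ) * polyOfGame R u := by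
  simp [polyOfGame, boundPoly]

lemma polyOfGame_ratePoly (R : MvPolynomial (Fin 3) ℕ) (u : (∀ i, A i) → B → ℝ) :
    polyOfGame (ratePoly R) u = 1 + polyOfGame (boundPoly R) u +
      72 * ((∑ i, Fintype.card (A i) : ℕ) : ℝ) ^ 2 +
      36 * polyOfGame R u * ((∑ i, Fintype.card (A i) : ℕ) : ℝ) ^ 4 * maxPayoff u ^ 2 +
      144 * ((∑ i, Fintype.card (A i) : ℕ) : ℝ) ^ 2 * polyOfGame (boundPoly R) u +
      32 * maxPayoff u ^ 4 := by
  simp [polyOfGame, ratePoly]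

/-- The decrease of one step, for a step size `c ε²` with small `c`. -/
lemma rate_le {ε c δ l ρ N V P k : ℝ} (hc : 0 < c) (hl : l ≤ ρ) (hk : 0 < k) (hkN : k ≤ N)
    (hcP : c * P ≤ 1) (hP1 : 72 * N ^ 2 ≤ P)
    (hP2 : 36 * ρ * N ^ 4 * V ^ 2 ≤ P)
    (hδ : δ ≤ c * ε ^ 4 / P) :
    -(2 * (c * ε ^ 2) * (ε / (6 * k)) ^ 2) + l * (c * ε ^ 2) ^ 2 * (N * V) ^ 2 + δ ≤
      -(c * ε ^ 4 / (72 * N ^ 2)) := by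
  have hN : 0 < N := hk.trans_le hkN
  have hK : 0 ≤ c * ε ^ 4 := by positivity
  -- In units of `cε⁴/(72N²)`: the gain is at least `4`, the gradient error at most `2`, and `δ` at
  -- most `1`, so one unit remains.
  have h1 : c * ε ^ 4 / (18 * N ^ 2) ≤ 2 * (c * ε ^ 2) * (ε / (6 * k)) ^ 2 := by
    have e : 2 * (c * ε ^ 2) * (ε / (6 * k)) ^ 2 = c * ε ^ 4 / (18 * k ^ 2) := by
      field_simp; ring
    rw [e]
    gcongr
  have h2 : l * (c * ε ^ 2) ^ 2 * (N * V) ^ 2 ≤ c * ε ^ 4 / (36 * N ^ 2) := by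
    rw [le_div_iff₀ (by positivity)]
    have h3 : c * (36 * l * N ^ 4 * V ^ 2) ≤ 1 := by
      refine le_trans (mul_le_mul_of_nonneg_left ?_ hc.le) hcP
      refine le_trans ?_ hP2
      gcongr
    calc _ = c * ε ^ 4 * (c * (36 * l * N ^ 4 * V ^ 2)) := by ring
      _ ≤ c * ε ^ 4 * 1 := mul_le_mul_of_nonneg_left h3 hK
      _ = _ := mul_one _
  have h3 : c * ε ^ 4 / P ≤ c * ε ^ 4 / (72 * N ^ 2) := by gcongr
  have h4 : c * ε ^ 4 / (18 * N ^ 2) = 4 * (c * ε ^ 4 / (72 * N ^ 2)) := by field_simp; ring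
  have h5 : c * ε ^ 4 / (36 * N ^ 2) = 2 * (c * ε ^ 4 / (72 * N ^ 2)) := by field_simp; ring
  linarith

end

end TeamGame

/-! ### The main theorem. -/

open TeamGame in
theorem mainTheorem3 :
    -- `U` has a polynomially bounded smoothness parameter
    (∃ R : MvPolynomial (Fin 3) ℕ,
      ∀ (n : ℕ) (_ : 0 < n) (A : Fin n → Type*) [∀ i, Fintype (A i)] [∀ i, Nonempty (A i)]
        (B : Type*) [Fintype B] [Nonempty B] (u : (∀ i, A i) → B → ℝ),
        0 < TeamGame.polyOfGame R u ∧ TeamGame.IsSmooth u (TeamGame.polyOfGame R u)) ∧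
    -- the potential decreases, is bounded, and the algorithm terminates
    (∀ R : MvPolynomial (Fin 3) ℕ, ∃ P : MvPolynomial (Fin 3) ℕ,
      ∀ (n : ℕ) (_ : 0 < n) (A : Fin n → Type*) [∀ i, Fintype (A i)] [∀ i, Nonempty (A i)]
        (B : Type*) [Fintype B] [Nonempty B] (u : (∀ i, A i) → B → ℝ)
        (l : ℝ) (_ : 0 < l) (_ : TeamGame.IsSmooth u l) (_ : l ≤ TeamGame.polyOfGame R u),
        1 ≤ TeamGame.polyOfGame P u ∧
        ∀ (ε : ℝ) (_ : 0 < ε)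
          (c : ℝ) (_ : 0 < c) (_ : c ≤ 1 / TeamGame.polyOfGame P u)
          (δ : ℝ) (_ : 0 ≤ δ) (_ : δ ≤ c * ε ^ 4 / TeamGame.polyOfGame P u)
          (prox : TeamGame.TeamVec A → TeamGame.TeamVec A)
          (_ : ∀ x ∈ TeamGame.teamStrategies A, TeamGame.IsApproxProx u l δ x (prox x)),
          (∀ x ∈ TeamGame.teamStrategies A,
            |TeamGame.potential u l prox x| ≤ TeamGame.polyOfGame P u) ∧
          ∀ (T : ℕ) (x : ℕ → TeamGame.TeamVec A) (y y' : ℕ → TeamGame.AdvVec B)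
            (_ : TeamGame.IsGDMaxRun u ε (c * ε ^ 2) T x y y'),
            (∀ t < T, TeamGame.NotTerminated u ε x y t →
              (0 < t ∨ TeamGame.IsExtendNE u (x 0) (y 0)) →
              TeamGame.potential u l prox (x (t + 1))
                < TeamGame.potential u l prox (x t) - c * ε ^ 4 / TeamGame.polyOfGame P u) ∧
            (TeamGame.polyOfGame P u / (c * ε ^ 4) ≤ (T : ℝ) →
              ∃ t : ℕ, (t : ℝ) ≤ TeamGame.polyOfGame P u / (c * ε ^ 4) ∧
                TeamGame.IsApproxNash u ε (x t) (y t))) := by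
  constructor
  · refine ⟨MvPolynomial.X 2 * (MvPolynomial.X 0 + MvPolynomial.X 1) ^ 2 + 1, ?_⟩
    intro n _ A _ _ B _ _ u
    have e : polyOfGame (MvPolynomial.X 2 * (MvPolynomial.X 0 + MvPolynomial.X 1) ^ 2 + 1) u =
        maxPayoff u * ((∑ i, Fintype.card (A i) : ℕ) + Fintype.card B) ^ 2 + 1 := by
      simp [polyOfGame]
    rw [e]
    -- The summand `1` keeps the parameter positive when all payoffs vanish.
    have := maxPayoff_nonneg u
    exact ⟨by positivity, isSmooth_of_size u⟩
  · intro R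
    refine ⟨ratePoly R, ?_⟩
    intro n hn A _ _ B _ _ u l hl hsm hlR
    have hG := polyOfGame_boundPoly R u
    have hP := polyOfGame_ratePoly R u
    have hnN : (n : ℝ) ≤ (∑ i, Fintype.card (A i) : ℕ) := by exact_mod_cast le_sum_card
    have hn1 : (0 : ℝ) < n := by exact_mod_cast hn
    have hV := maxPayoff_nonneg u
    set N : ℝ := ((∑ i, Fintype.card (A i) : ℕ) : ℝ) with hNdef
    set V := maxPayoff u with hVdef
    set ρ := polyOfGame R u with hρdef
    set G := polyOfGame (boundPoly R) u with hGdef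
    set P := polyOfGame (ratePoly R) u with hPdef
    have hρ : 0 < ρ := hl.trans_le hlR
    have hN : 0 < N := hn1.trans_le hnN
    have hG0 : 0 ≤ G := by rw [hG]; positivity
    have t1 : 0 ≤ 72 * N ^ 2 := by positivity
    have t2 : 0 ≤ 36 * ρ * N ^ 4 * V ^ 2 := by positivity
    have t3 : 0 ≤ 144 * N ^ 2 * G := by positivity
    have t4 : 0 ≤ 32 * V ^ 4 := by positivity
    have hP1 : 1 ≤ P := by linarith
    have hP0 : 0 < P := by linarith
    refine ⟨hP1, ?_⟩
    intro ε hε c hc hcP δ _ hδ prox hprox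
    have hcP' : c * P ≤ 1 := (le_div_iff₀ hP0).mp hcP
    have hbound : ∀ x ∈ teamStrategies A, |potential u l prox x| ≤ G := by
      intro x hx
      refine (abs_potential_le hl.le hx (hprox x hx)).trans ?_
      have : l * (4 * n) ≤ ρ * (4 * N) := by gcongr
      rw [hG]; linarith
    refine ⟨fun x hx => (hbound x hx).trans (by linarith), ?_⟩
    intro T x y y' hrun
    set K := c * ε ^ 4 with hK
    have hK0 : 0 < K := by positivity
    -- The iteration count needs this decrease, sharper than the claimed `K / P`: with `K / P` alone
    -- the bound would be of order `P * G / K` instead of `P / K`.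
    have hstep : ∀ t < T, NotTerminated u ε x y t → (0 < t ∨ IsExtendNE u (x 0) (y 0)) →
        potential u l prox (x (t + 1)) < potential u l prox (x t) - K / (72 * N ^ 2) := by
      intro t ht hnt h0
      have hE : IsExtendNE u (x t) (y t) := by
        rcases Nat.eq_zero_or_pos t with rfl | htpos
        · exact h0.resolve_left (lt_irrefl _)
        · exact hrun.isExtendNE ht hnt htpos
      have h1 := potential_step_lt hsm hl hn hprox hε (η := c * ε ^ 2) (by positivity)
        (hrun.team_mem ht.le fun s hs => hnt.mono hs.le) hE (hnt t le_rfl)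
        (hrun.best_response t ht hnt) (hrun.gradient_step t ht hnt)
      have h2 := rate_le (ε := ε) (N := N) (V := V) hc hlR hn1 hnN hcP' (by linarith)
        (by linarith) hδ
      linarith
    refine ⟨fun t ht hnt h0 => ?_, fun hT => ?_⟩
    · have h1 := hstep t ht hnt h0
      have h2 : K / P ≤ K / (72 * N ^ 2) := by
        have : 72 * N ^ 2 ≤ P := by linarith
        gcongr
      linarith
    · by_contra hcon
      push Not at hcon
      have hε2 : ε < 2 * V := by
        by_contra hle
        push Not at hle
        exact hcon 0 (by rw [Nat.cast_zero]; positivity)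
          (isApproxNash_of_two_mul_maxPayoff_le hrun.init_team hrun.init_adv hle)
      have hKV : K ≤ 16 * V ^ 4 := by
        have h1 : ε ^ 4 ≤ (2 * V) ^ 4 := pow_le_pow_left₀ hε.le hε2.le 4
        have h2 : c ≤ 1 := by nlinarith
        nlinarith [pow_pos hε 4]
      have hX1 : 1 ≤ P / K := by rw [le_div_iff₀ hK0]; linarith
      -- Here `⌊P / K⌋ = m + 1`. The first step is not counted, since `y 0` need not come from
      -- `ExtendNE`; `m` guaranteed decreases remain.
      obtain ⟨m, hm⟩ := Nat.exists_eq_succ_of_ne_zero (Nat.floor_pos.mpr hX1).ne'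
      have hmX : ((m + 1 : ℕ) : ℝ) ≤ P / K := by
        rw [← Nat.succ_eq_add_one, ← hm]; exact Nat.floor_le (by positivity)
      have hXm : P / K < m + 2 := by
        have := Nat.lt_floor_add_one (P / K)
        rw [hm] at this
        push_cast at this
        linarith
      have hmT : m + 1 ≤ T := by exact_mod_cast hmX.trans hT
      have hnt : ∀ t, t < m + 1 → NotTerminated u ε x y t := fun t ht s hs =>
        hcon s (le_trans (by exact_mod_cast (by omega : s ≤ m + 1)) hmX)
      have h1 := le_of_forall_decrease (g := fun t => potential u l prox (x t))
        (d := K / (72 * N ^ 2)) (m := m) fun t ht0 ht =>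
          (hstep t (by omega) (hnt t ht) (Or.inl ht0)).le
      have h2 := abs_le.mp (hbound _ (hrun.team_mem hmT hnt))
      have h3 := abs_le.mp (hbound _ (hrun.team_mem (t := 1) (by omega)
        fun s hs => hnt s (by omega)))
      have h4 : m * (K / (72 * N ^ 2)) ≤ 2 * G := by linarith
      -- Now `m * K ≤ 144N²G`, whereas `P < (m + 2) * K ≤ 144N²G + 32V⁴`, contradicting the choice
      -- of `P`.
      rw [← mul_div_assoc, div_le_iff₀ (by positivity)] at h4
      rw [div_lt_iff₀ hK0] at hXm
      linarith
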